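/- Let $n\ge 0$ be an integer and $V=\mathbb C^{2n}$. The rank of a 2-vector $\gamma\in\wedge^2V$ is the smallest dimension of a subspace $U\subseteq V$ with $\gamma\in\wedge^2U$. "General" means: for all elements of some nonempty Zariski open subset of the parameter space, which is $\wedge^2V\times\wedge^2V$ for pairs of 2-vectors and the Grassmannian of lines in $\mathbb P(\wedge^2V)$ for lines in Plücker space. (1) For a general pair $(\alpha,\alpha')$ in $\wedge^2V\times\wedge^2V$ there exist 2-vectors $\gamma_1,\dots,\gamma_n\in\wedge^2V$ of rank $2$ such that both $\alpha$ and $\alpha'$ are linear combinations of $\gamma_1,\dots,\gamma_n$. This $n$-tuple is unique up to order and scalars: if $\delta_1,\dots,\delta_n$ is another such $n$-tuple, then there are a permutation $\sigma$ of $\{1,\dots,n\}$ and nonzero scalars $c_i\in\mathbb C$ with $\delta_i=c_i\gamma_{\sigma(i)}$ for all $i$. (2) Let $n\ge 2$ and let $G(2,2n)\subset\mathbb P(\wedge^2V)$ be the Grassmannian of two-dimensional subspaces of $V$ in its Plücker embedding $U\mapsto\wedge^2U$. By an $n$-secant $(n-1)$-space to $G(2,2n)$ we mean an $(n-1)$-dimensional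 linear subspace of $\mathbb P(\wedge^2V)$ that is spanned by $n$ points of $G(2,2n)$. Then a general line in $\mathbb P(\wedge^2V)$ is contained in a unique $n$-secant $(n-1)$-space to $G(2,2n)$, and this space meets $G(2,2n)$ in exactly $n$ points. -/

import Mathlib

open scoped LinearAlgebra.Projectivization

namespace TwoVector

section Zariski

variable {W : Type*} [AddCommGroup W] [Module ℂ W]

/-- The common zero set in `W` of a set of polynomials in the linear forms on `W`, that is, of a
set of polynomial functions on the vector space `W`. -/
def zeroLocus (S : Set (MvPolynomial (Module.Dual ℂ W) ℂ)) : Set W :=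
  {w | ∀ p ∈ S, MvPolynomial.eval (fun φ : Module.Dual ℂ W => φ w) p = 0}

/-- A subset of the vector space `W` is Zariski open if its complement is the zero locus of a set
of polynomial functions. -/
def IsZariskiOpen (U : Set W) : Prop :=
  ∃ S : Set (MvPolynomial (Module.Dual ℂ W) ℂ), Uᶜ = zeroLocus S

/-- A property holds for a general element of `W` if it holds on a nonempty Zariski open subset. -/
def HoldsGenerally (p : W → Prop) : Prop :=
  ∃ U : Set W, IsZariskiOpen U ∧ U.Nonempty ∧ ∀ w ∈ U, p w

variable (W) in
/-- The lines of the projective space `ℙ(W)`, i.e. the two-dimensional subspaces of `W`. -/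
abbrev ProjLine : Type _ := {L : Submodule ℂ W // Module.finrank ℂ L = 2}

/-- The Zariski topology of the Grassmannian of lines in `ℙ(W)`, described as the quotient topology
from frames: a set of lines is open if the set of the pairs in `W × W` that are a basis of one of
these lines is Zariski open. (The pairs that are a basis of some line form an open set.) -/
def IsZariskiOpenLines (U : Set (ProjLine W)) : Prop :=
  IsZariskiOpen {w : W × W | ∃ L ∈ U, Submodule.span ℂ {w.1, w.2} = L.1}

/-- A property holds for a general line of `ℙ(W)` if it holds on a nonempty Zariski open subset of
the Grassmannian of lines. -/
def HoldsForGeneralLine (p : ProjLine W → Prop) : Prop :=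
  ∃ U : Set (ProjLine W), IsZariskiOpenLines U ∧ U.Nonempty ∧ ∀ L ∈ U, p L

end Zariski

/-- The subspace `⋀² U` of `⋀² V` for a subspace `U` of `V`. -/
noncomputable def wedgeTwo {V : Type*} [AddCommGroup V] [Module ℂ V] (U : Submodule ℂ V) :
    Submodule ℂ (⋀[ℂ]^2 V) :=
  LinearMap.range (exteriorPower.map 2 U.subtype)

/-- The rank of a 2-vector `γ`: the least dimension of a subspace `U` with `γ ∈ ⋀² U`. -/
noncomputable def rank {V : Type*} [AddCommGroup V] [Module ℂ V] (γ : ⋀[ℂ]^2 V) : ℕ :=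
  sInf {r : ℕ | ∃ U : Submodule ℂ V, Module.finrank ℂ U = r ∧ γ ∈ wedgeTwo U}

/-- The vector space `⋀² ℂ²ⁿ`; the Plücker space is its projectivization. -/
abbrev Pluecker (n : ℕ) : Type := ⋀[ℂ]^2 (Fin (2 * n) → ℂ)

/-- The Grassmannian `G(2, 2n)` in Plücker space: the set of the points `⋀² U`, for `U` a
two-dimensional subspace of `ℂ²ⁿ`. -/
def grassmannian (n : ℕ) : Set (ℙ ℂ (Pluecker n)) :=
  {x | ∃ U : Submodule ℂ (Fin (2 * n) → ℂ), Module.finrank ℂ U = 2 ∧ x.submodule = wedgeTwo U}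

/-- `γ₁, …, γₙ` have rank 2, and `α` and `α'` are linear combinations of them. -/
def IsDiagonalizing {n : ℕ} (α α' : Pluecker n) (γ : Fin n → Pluecker n) : Prop :=
  (∀ i, rank (γ i) = 2) ∧
    (∃ a : Fin n → ℂ, α = ∑ i, a i • γ i) ∧ (∃ b : Fin n → ℂ, α' = ∑ i, b i • γ i)

/-- An `n`-secant `(n - 1)`-space to `G(2, 2n)`: an `(n - 1)`-dimensional projective subspace
of the Plücker space (given by an `n`-dimensional vector subspace) spanned by `n` points
of `G(2, 2n)`. -/
def IsSecantSpace {n : ℕ} (P : Submodule ℂ (Pluecker n)) : Prop :=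
  Module.finrank ℂ P = n ∧
    ∃ x : Fin n → ℙ ℂ (Pluecker n), (∀ i, x i ∈ grassmannian n) ∧ P = ⨆ i, (x i).submodule

end TwoVector

/-! Contraction turns a 2-vector `α` of `V` into a skew map `V* → V`. If this map is invertible, put
`M = contract α' ∘ (contract α)⁻¹` (up to a nonzero scalar). The eigenspace of `M` for `μ` is the
image of the kernel of the skew form `α' - μ α`. On an even-dimensional space that kernel is not
one-dimensional, so every eigenvalue has multiplicity at least two (`two_le_finrank_eigenspace`).

If `M` has `n` distinct eigenvalues, its eigenspaces are therefore planes with direct sum `V`.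
Skewness makes distinct planes orthogonal for `α` and `α'`, so both are combinations of the `n`
2-vectors of these planes. Conversely, in any decomposition with summands `p i ∧ q i`, the `p i` and
`q i` form a basis of eigenvectors of `M`. The planes are thus forced
(`exists_unique_decomposition`).

Genericity is the nonvanishing of one polynomial: `det A` times the Hankel determinant of the traces
of powers of `M`.

For lines, a secant space containing the span of `α` and `α'` is the span of a diagonalizing tuple,
hence unique. A further point of the Grassmannian in it could be exchanged for some `γ i`, against
uniqueness (`secantSpace_of_unique`). -/

namespace TwoVector

/-! ### Decomposable 2-vectors and contraction with linear forms. -/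

section Wedge

variable {V : Type*} [AddCommGroup V] [Module ℂ V]

/-- The 2-vector `u ∧ v`. -/
noncomputable def wedge (u v : V) : ⋀[ℂ]^2 V := exteriorPower.ιMulti ℂ 2 ![u, v]

/-- The alternating map underlying `contract`. -/
noncomputable def contractAlternating :
    V [⋀^Fin 2]→ₗ[ℂ] (Module.Dual ℂ V →ₗ[ℂ] V) where
  toFun m := (Module.Dual.eval ℂ V (m 1)).smulRight (m 0) -
    (Module.Dual.eval ℂ V (m 0)).smulRight (m 1)
  map_update_add' m i x y := by
    ext f
    fin_cases i <;> simp [add_smul] <;> abel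
  map_update_smul' m i c x := by
    ext f
    fin_cases i <;> simp [mul_smul, smul_sub, smul_comm c]
  map_eq_zero_of_eq' m i j h hij := by
    have : m 0 = m 1 := by
      fin_cases i <;> fin_cases j <;> simp_all
    ext f
    simp [this]

/-- Contraction of a 2-vector with a linear form. -/
noncomputable def contract : ⋀[ℂ]^2 V →ₗ[ℂ] Module.Dual ℂ V →ₗ[ℂ] V :=
  exteriorPower.alternatingMapLinearEquiv contractAlternating

@[simp]
lemma contract_wedge (u v : V) (f : Module.Dual ℂ V) :
    contract (wedge u v) f = f v • u - f u • v := by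
  simp [contract, wedge, contractAlternating]

lemma update_pair_zero {X : Type*} (u v x : X) : Function.update ![u, v] 0 x = ![x, v] := by
  ext i
  fin_cases i <;> rfl

lemma update_pair_one {X : Type*} (u v x : X) : Function.update ![u, v] 1 x = ![u, x] := by
  ext i
  fin_cases i <;> rfl

/-- The wedge product as a bilinear map. -/
noncomputable def wedgeBilin : V →ₗ[ℂ] V →ₗ[ℂ] ⋀[ℂ]^2 V :=
  LinearMap.mk₂ ℂ wedge
    (fun u u' v => by
      have h := (exteriorPower.ιMulti ℂ 2 (M := V)).map_update_add ![u, v] 0 u u'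
      rwa [update_pair_zero, update_pair_zero, update_pair_zero] at h)
    (fun c u v => by
      have h := (exteriorPower.ιMulti ℂ 2 (M := V)).map_update_smul ![u, v] 0 c u
      rwa [update_pair_zero, update_pair_zero] at h)
    (fun u v v' => by
      have h := (exteriorPower.ιMulti ℂ 2 (M := V)).map_update_add ![u, v] 1 v v'
      rwa [update_pair_one, update_pair_one, update_pair_one] at h)
    (fun c u v => by
      have h := (exteriorPower.ιMulti ℂ 2 (M := V)).map_update_smul ![u, v] 1 c v
      rwa [update_pair_one, update_pair_one] at h)

@[simp] lemma wedgeBilin_apply (u v : V) : wedgeBilin u v = wedge u v := rfl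

lemma wedge_add_left (u u' v : V) : wedge (u + u') v = wedge u v + wedge u' v := by
  simp [← wedgeBilin_apply]

lemma wedge_add_right (u v v' : V) : wedge u (v + v') = wedge u v + wedge u v' := by
  simp [← wedgeBilin_apply]

lemma wedge_smul_left (c : ℂ) (u v : V) : wedge (c • u) v = c • wedge u v := by
  simp [← wedgeBilin_apply]

lemma wedge_smul_right (c : ℂ) (u v : V) : wedge u (c • v) = c • wedge u v := by
  simp [← wedgeBilin_apply]

@[simp] lemma wedge_self (u : V) : wedge u u = 0 :=
  (exteriorPower.ιMulti ℂ 2 (M := V)).map_eq_zero_of_eq ![u, u] (i := 0) (j := 1) rfl (by simp)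

lemma wedge_swap (u v : V) : wedge v u = -wedge u v := by
  have h : wedge (u + v) (u + v) = 0 := wedge_self _
  rw [wedge_add_left, wedge_add_right, wedge_add_right] at h
  rw [wedge_self, wedge_self, zero_add, add_zero] at h
  exact eq_neg_of_add_eq_zero_right h

/-- Allows linear identities in a 2-vector to be checked on decomposable ones. -/
lemma span_wedge_eq_top :
    Submodule.span ℂ (Set.range fun p : V × V => wedge p.1 p.2) = ⊤ := by
  rw [eq_top_iff, ← exteriorPower.ιMulti_span ℂ 2 V, Submodule.span_le]
  rintro _ ⟨m, rfl⟩
  refine Submodule.subset_span ⟨(m 0, m 1), ?_⟩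
  simp only [wedge]
  congr 1
  ext i
  fin_cases i <;> rfl

/-- Contraction of a 2-vector is alternating. -/
lemma apply_contract_self (γ : ⋀[ℂ]^2 V) (f : Module.Dual ℂ V) : f (contract γ f) = 0 := by
  have h : f ∘ₗ (contract.flip f) = 0 := by
    refine LinearMap.ext_on_range span_wedge_eq_top fun p => ?_
    simp [mul_comm]
  exact LinearMap.congr_fun h γ

lemma apply_contract_swap (γ : ⋀[ℂ]^2 V) (f g : Module.Dual ℂ V) :
    f (contract γ g) = -g (contract γ f) := by
  have h := apply_contract_self γ (f + g)
  simp only [map_add, LinearMap.add_apply, apply_contract_self, zero_add, add_zero] at h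
  exact eq_neg_of_add_eq_zero_right h

/-- Recovers a 2-vector from its contractions. The factor 2 arises because `u ∧ v` contributes `u ∧
v - v ∧ u`. -/
lemma sum_wedge_contract {ι : Type*} [Fintype ι] (b : Module.Basis ι ℂ V) (γ : ⋀[ℂ]^2 V) :
    ∑ i, wedge (contract γ (b.coord i)) (b i) = (2 : ℂ) • γ := by
  have h : ∑ i, (wedgeBilin.flip (b i)) ∘ₗ (contract.flip (b.coord i)) =
      (2 : ℂ) • (LinearMap.id : ⋀[ℂ]^2 V →ₗ[ℂ] ⋀[ℂ]^2 V) := by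
    refine LinearMap.ext_on_range span_wedge_eq_top fun p => ?_
    have key : ∀ u v : V, ∑ i, wedge (b.coord i v • u) (b i) = wedge u v := fun u v => by
      conv_rhs => rw [← b.sum_repr v, ← wedgeBilin_apply, map_sum]
      simp [← wedgeBilin_apply]
    have h2 : ∑ i, wedge (contract (wedge p.1 p.2) (b.coord i)) (b i) =
        wedge p.1 p.2 - wedge p.2 p.1 := by
      rw [← key p.1 p.2, ← key p.2 p.1, ← Finset.sum_sub_distrib, key p.1 p.2]
      refine Finset.sum_congr rfl fun i _ => ?_
      rw [contract_wedge]
      simp [← wedgeBilin_apply]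
    simp only [LinearMap.sum_apply, LinearMap.comp_apply, LinearMap.flip_apply, wedgeBilin_apply,
      LinearMap.smul_apply, LinearMap.id_apply]
    rw [h2, wedge_swap p.1 p.2, two_smul, sub_neg_eq_add]
  simpa using LinearMap.congr_fun h γ

lemma wedge_ne_zero {u v : V} (h : LinearIndependent ℂ ![u, v]) : wedge u v ≠ 0 := by
  intro h0
  have hu : ∀ f : Module.Dual ℂ V, f v = 0 := fun f => by
    have := contract_wedge u v f
    rw [h0, map_zero, LinearMap.zero_apply] at this
    have := LinearIndependent.pair_iff.1 h (f v) (-f u) (by rw [neg_smul, ← sub_eq_add_neg, ← this])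
    exact this.1
  exact h.ne_zero 1 (by simpa using (Module.forall_dual_apply_eq_zero_iff ℂ v).1 hu)

lemma wedge_mem_wedgeTwo {U : Submodule ℂ V} {u v : V} (hu : u ∈ U) (hv : v ∈ U) :
    wedge u v ∈ wedgeTwo U := by
  refine ⟨wedge ⟨u, hu⟩ ⟨v, hv⟩, ?_⟩
  rw [wedge, exteriorPower.map_apply_ιMulti, wedge]
  congr 1
  ext i
  fin_cases i <;> rfl

lemma wedgeTwo_le {U : Submodule ℂ V} {P : Submodule ℂ (⋀[ℂ]^2 V)}
    (h : ∀ u ∈ U, ∀ v ∈ U, wedge u v ∈ P) : wedgeTwo U ≤ P := by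
  rw [wedgeTwo, LinearMap.range_eq_map, ← span_wedge_eq_top, Submodule.map_span, Submodule.span_le]
  rintro _ ⟨_, ⟨p, rfl⟩, rfl⟩
  have : exteriorPower.map 2 U.subtype (wedge p.1 p.2) = wedge (p.1 : V) p.2 := by
    rw [wedge, exteriorPower.map_apply_ιMulti, wedge]
    congr 1
    ext i
    fin_cases i <;> rfl
  simp only [this]
  exact h _ p.1.2 _ p.2.2

lemma wedgeTwo_span_pair (u v : V) :
    wedgeTwo (Submodule.span ℂ {u, v}) = Submodule.span ℂ {wedge u v} := by
  refine le_antisymm (wedgeTwo_le fun x hx y hy => ?_) ?_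
  · obtain ⟨a, b, rfl⟩ := Submodule.mem_span_pair.1 hx
    obtain ⟨c, d, rfl⟩ := Submodule.mem_span_pair.1 hy
    refine Submodule.mem_span_singleton.2 ⟨a * d - b * c, ?_⟩
    simp only [wedge_add_left, wedge_add_right, wedge_smul_left, wedge_smul_right, wedge_self,
      wedge_swap u v]
    module
  · rw [Submodule.span_singleton_le_iff_mem]
    exact wedge_mem_wedgeTwo (Submodule.subset_span (by simp)) (Submodule.subset_span (by simp))

lemma wedgeTwo_eq_bot {U : Submodule ℂ V} [FiniteDimensional ℂ U]
    (h : Module.finrank ℂ U < 2) : wedgeTwo U = ⊥ := by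
  obtain ⟨w, hw⟩ := finrank_le_one_iff.1 (Nat.lt_succ_iff.1 h)
  refine eq_bot_iff.2 (wedgeTwo_le fun u hu v hv => ?_)
  obtain ⟨a, ha⟩ := hw ⟨u, hu⟩
  obtain ⟨b, hb⟩ := hw ⟨v, hv⟩
  have hu' : u = a • (w : V) := by rw [← Submodule.coe_smul, ha]
  have hv' : v = b • (w : V) := by rw [← Submodule.coe_smul, hb]
  simp [hu', hv', wedge_smul_left, wedge_smul_right]

lemma exists_span_pair_of_finrank_eq_two {U : Submodule ℂ V} (h : Module.finrank ℂ U = 2) :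
    ∃ u v : V, LinearIndependent ℂ ![u, v] ∧ U = Submodule.span ℂ {u, v} := by
  have : FiniteDimensional ℂ U := Module.finite_of_finrank_pos (by omega)
  let b := Module.finBasisOfFinrankEq ℂ U h
  have hb : U.subtype ∘ b = ![(b 0 : V), (b 1 : V)] := by
    ext i
    fin_cases i <;> rfl
  refine ⟨b 0, b 1, ?_, ?_⟩
  · rw [← hb]
    exact b.linearIndependent.map' _ U.ker_subtype
  · have h1 : Submodule.span ℂ (Set.range (U.subtype ∘ b)) = U := by
      rw [Set.range_comp, ← Submodule.map_span, b.span_eq, Submodule.map_top, U.range_subtype]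
    rw [hb, Matrix.range_cons_cons_empty] at h1
    exact h1.symm

lemma finrank_span_pair_eq_two {u v : V} (h : LinearIndependent ℂ ![u, v]) :
    Module.finrank ℂ (Submodule.span ℂ {u, v}) = 2 := by
  have := finrank_span_eq_card h
  rwa [Matrix.range_cons_cons_empty, Fintype.card_fin] at this

/-- The 2-vectors of rank 2 are the nonzero decomposable ones. -/
lemma rank_eq_two_iff [FiniteDimensional ℂ V] (γ : ⋀[ℂ]^2 V) :
    rank γ = 2 ↔ ∃ u v : V, LinearIndependent ℂ ![u, v] ∧ γ = wedge u v := by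
  constructor
  · intro h
    -- The infimum of the empty set is `0`, so the value 2 guarantees that it is attained.
    have hne : {r : ℕ | ∃ U : Submodule ℂ V, Module.finrank ℂ U = r ∧ γ ∈ wedgeTwo U}.Nonempty :=
      Nat.nonempty_of_pos_sInf (by rw [rank] at h; omega)
    obtain ⟨U, hU, hγ⟩ := Nat.sInf_mem hne
    have hU2 : Module.finrank ℂ U = 2 := hU.trans h
    obtain ⟨u, v, huv, rfl⟩ := exists_span_pair_of_finrank_eq_two hU2
    rw [wedgeTwo_span_pair] at hγ
    obtain ⟨c, rfl⟩ := Submodule.mem_span_singleton.1 hγ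
    have hc : c ≠ 0 := by
      rintro rfl
      have : rank ((0 : ℂ) • wedge u v) ≤ 0 := Nat.sInf_le ⟨⊥, by simp, by simp⟩
      omega
    refine ⟨c • u, v, ?_, (wedge_smul_left _ _ _).symm⟩
    rw [LinearIndependent.pair_iff] at huv ⊢
    intro s t hst
    obtain ⟨h1, h2⟩ := huv (s * c) t (by rwa [mul_smul])
    exact ⟨(mul_eq_zero.1 h1).resolve_right hc, h2⟩
  · rintro ⟨u, v, huv, rfl⟩
    refine le_antisymm (Nat.sInf_le ⟨_, finrank_span_pair_eq_two huv, ?_⟩)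
      (le_csInf ⟨2, _, finrank_span_pair_eq_two huv, ?_⟩ ?_)
    · rw [wedgeTwo_span_pair]
      exact Submodule.mem_span_singleton_self _
    · rw [wedgeTwo_span_pair]
      exact Submodule.mem_span_singleton_self _
    · rintro r ⟨U, rfl, hU⟩
      by_contra! hlt
      rw [wedgeTwo_eq_bot hlt] at hU
      exact wedge_ne_zero huv hU

end Wedge

/-! ### Counting eigenvalues by traces, and kernels of alternating forms. -/

section LinearAlgebra

open Polynomial in
lemma multiset_prod_dvd_pow_card {R : Type*} [CommRing R] {q : R[X]} (s : Multiset R)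
    (h : ∀ a ∈ s, X - C a ∣ q) : (s.map fun a => X - C a).prod ∣ q ^ s.card := by
  induction s using Multiset.induction_on with
  | empty => simp
  | cons a s ih =>
    rw [Multiset.map_cons, Multiset.prod_cons, Multiset.card_cons, pow_succ']
    exact mul_dvd_mul (h a (by simp)) (ih fun b hb => h b (by simp [hb]))

open Polynomial in
/-- If the Hankel matrix of the first traces of powers of `N` is invertible, then `N` has at least
as many distinct eigenvalues as the size of the Hankel matrix. -/
lemma le_card_roots_charpoly {ι : Type*} [Fintype ι] [DecidableEq ι] (N : Matrix ι ι ℂ) {n : ℕ}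
    (h : (Matrix.of fun i j : Fin n => (N ^ (i + j : ℕ)).trace).det ≠ 0) :
    n ≤ N.charpoly.roots.toFinset.card := by
  by_contra! hlt
  -- `q` has the eigenvalues as simple roots, so `q(N)` is nilpotent and every `N ^ i * q(N)` has
  -- trace zero. Hence the coefficients of `q`, of degree below `n`, form a null vector of the
  -- Hankel matrix.
  set q : ℂ[X] := ∏ a ∈ N.charpoly.roots.toFinset, (X - C a) with hq
  have hqm : q.Monic := monic_prod_of_monic _ _ fun a _ => monic_X_sub_C a
  have hqd : q.natDegree < n := by
    rw [hq, natDegree_prod_of_monic _ _ fun a _ => monic_X_sub_C a]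
    simpa using hlt
  have hnil : IsNilpotent (aeval N q) := by
    refine ⟨N.charpoly.roots.card, ?_⟩
    have hdvd : N.charpoly ∣ q ^ N.charpoly.roots.card := by
      conv_lhs => rw [(IsAlgClosed.splits N.charpoly).eq_prod_roots_of_monic N.charpoly_monic]
      exact multiset_prod_dvd_pow_card _ fun a ha =>
        Finset.dvd_prod_of_mem _ (Multiset.mem_toFinset.2 ha)
    obtain ⟨r, hr⟩ := hdvd
    rw [← map_pow, hr, map_mul, Matrix.aeval_self_charpoly, zero_mul]
  refine h (Matrix.exists_mulVec_eq_zero_iff.1 ⟨fun j => q.coeff j, ?_, ?_⟩)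
  · intro h0
    have := congrFun h0 ⟨q.natDegree, hqd⟩
    simp [hqm.coeff_natDegree] at this
  · ext i
    have h1 : (N ^ (i : ℕ) * aeval N q).trace = 0 := by
      have : Commute (N ^ (i : ℕ)) (aeval N q) := by
        have := Commute.all (X ^ (i : ℕ)) q
        simpa using this.map (aeval N)
      exact (Matrix.isNilpotent_trace_of_isNilpotent (this.isNilpotent_mul_left hnil)).eq_zero
    rw [aeval_eq_sum_range' hqd, Finset.mul_sum, Matrix.trace_sum,
      Finset.sum_range fun j => (N ^ (i : ℕ) * q.coeff j • N ^ j).trace] at h1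
    simpa [Matrix.mulVec, dotProduct, pow_add, Matrix.trace_smul, mul_comm] using h1

/-- An alternating bilinear form on an even-dimensional space has no one-dimensional
kernel. -/
lemma finrank_ker_ne_one {X : Type*} [AddCommGroup X] [Module ℂ X] [FiniteDimensional ℂ X]
    (B : LinearMap.BilinForm ℂ X) (hB : ∀ x, B x x = 0) (hX : Even (Module.finrank ℂ X)) :
    Module.finrank ℂ (LinearMap.ker B) ≠ 1 := by
  intro h1
  have hskew : ∀ x y, B x y = -B y x := fun x y => by
    have h := hB (x + y)
    simp only [map_add, LinearMap.add_apply, hB, zero_add, add_zero] at h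
    exact eq_neg_of_add_eq_zero_left (by rw [add_comm]; exact h)
  -- With a one-dimensional kernel, a complement `W` would have odd dimension. The skew Gram matrix
  -- on `W` would be singular, and a null vector would lie in both `W` and the kernel.
  obtain ⟨W, hW⟩ := Submodule.exists_isCompl (LinearMap.ker B)
  have hdim := Submodule.finrank_add_eq_of_isCompl hW
  have hodd : Odd (Module.finrank ℂ W) := by
    rw [h1] at hdim
    rw [← hdim] at hX
    by_contra hne
    rw [Nat.not_odd_iff_even] at hne
    exact Nat.not_even_one ((Nat.even_add.1 hX).2 hne)
  let b := Module.finBasis ℂ W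
  let G : Matrix (Fin (Module.finrank ℂ W)) (Fin (Module.finrank ℂ W)) ℂ :=
    Matrix.of fun i j => B (b i) (b j)
  have hG : G.det = 0 := by
    have hT : G.transpose = -G := by
      ext i j
      exact hskew _ _
    have := congrArg Matrix.det hT
    rw [Matrix.det_transpose, Matrix.det_neg, Fintype.card_fin, hodd.neg_one_pow] at this
    linear_combination this / 2
  obtain ⟨v, hv, hGv⟩ := Matrix.exists_mulVec_eq_zero_iff.2 hG
  set w : W := ∑ j, v j • b j with hw
  have hwb : ∀ x : W, B (x : X) w = 0 := by
    intro x
    have hlin : (B.flip (w : X)) ∘ₗ W.subtype = 0 := by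
      refine b.ext fun i => ?_
      have := congrFun hGv i
      simp only [LinearMap.comp_apply, Submodule.subtype_apply, hw,
        Submodule.coe_sum, Submodule.coe_smul, map_sum, map_smul, LinearMap.zero_apply]
      simpa [Matrix.mulVec, dotProduct, G, mul_comm] using this
    exact LinearMap.congr_fun hlin x
  have hker : (w : X) ∈ LinearMap.ker B := by
    rw [LinearMap.mem_ker]
    ext y
    obtain ⟨k, hk, x, hx, rfl⟩ : ∃ k ∈ LinearMap.ker B, ∃ x ∈ W, k + x = y :=
      Submodule.mem_sup.1 (by rw [hW.sup_eq_top]; trivial)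
    have hk0 : B k = 0 := hk
    rw [hskew, map_add, LinearMap.add_apply, hk0, hwb ⟨x, hx⟩]
    simp
  have hw0 : w = 0 := by
    have := Submodule.disjoint_def.1 hW.disjoint _ hker w.2
    exact Subtype.ext this
  refine hv (funext fun i => ?_)
  exact Fintype.linearIndependent_iff.1 b.linearIndependent v (hw ▸ hw0) i

end LinearAlgebra

/-! ### Simultaneous diagonalization of two 2-vectors and its uniqueness. -/

section Diagonalization

variable {V : Type*} [AddCommGroup V] [Module ℂ V] {n : ℕ}

/-- The eigenvalues of the quotient of two alternating maps on an even-dimensional space have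
multiplicity at least two. -/
lemma two_le_finrank_eigenspace [FiniteDimensional ℂ V] {α α' : ⋀[ℂ]^2 V} {M : Module.End ℂ V}
    (hV : Even (Module.finrank ℂ V)) (hα : Function.Injective (contract α))
    (hM : ∀ f, M (contract α f) = contract α' f) {μ : ℂ} (hμ : M.HasEigenvalue μ) :
    2 ≤ Module.finrank ℂ (M.eigenspace μ) := by
  set β := α' - μ • α with hβ
  let B : LinearMap.BilinForm ℂ (Module.Dual ℂ V) := Module.Dual.eval ℂ V ∘ₗ contract β
  have hBker : LinearMap.ker B = LinearMap.ker (contract β) :=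
    LinearMap.ker_comp_of_ker_eq_bot _ (Module.eval_ker ℂ V)
  have hB : Module.finrank ℂ (LinearMap.ker (contract β)) ≠ 1 := by
    rw [← hBker]
    exact finrank_ker_ne_one B (fun f => apply_contract_self β f)
      (by rwa [Subspace.dual_finrank_eq])
  have hsurj : Function.Surjective (contract α) :=
    (LinearMap.injective_iff_surjective_of_finrank_eq_finrank Subspace.dual_finrank_eq).1 hα
  have hmap : (LinearMap.ker (contract β)).map (contract α) = M.eigenspace μ := by
    have hiff : ∀ f, contract β f = 0 ↔ M (contract α f) = μ • contract α f := fun f => by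
      rw [hM, ← sub_eq_zero (a := contract α' f), hβ]
      simp
    ext x
    simp only [Submodule.mem_map, LinearMap.mem_ker, Module.End.mem_eigenspace_iff]
    constructor
    · rintro ⟨f, hf, rfl⟩
      exact (hiff f).1 hf
    · intro hx
      obtain ⟨f, rfl⟩ := hsurj x
      exact ⟨f, (hiff f).2 hx, rfl⟩
  have hfin := (Submodule.equivMapOfInjective _ hα (LinearMap.ker (contract β))).finrank_eq
  rw [hmap] at hfin
  have hne : Module.finrank ℂ (M.eigenspace μ) ≠ 0 := fun h0 =>
    hμ (Submodule.finrank_eq_zero.1 h0)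
  omega

/-- An endomorphism with `n` eigenvalues of multiplicity at least two on a `2n`-dimensional space
has a basis of eigenvectors. -/
lemma exists_eigenbasis [FiniteDimensional ℂ V] (M : Module.End ℂ V) (hV : Module.finrank ℂ V = 2 * n) {l : Fin n → ℂ}
    (hl : Function.Injective l) (h2 : ∀ i, 2 ≤ Module.finrank ℂ (M.eigenspace (l i))) :
    ∃ b : Module.Basis (Fin n × Fin 2) ℂ V, ∀ k, M (b k) = l k.1 • b k := by
  choose f hf using fun i => exists_linearIndependent_of_le_finrank (h2 i)
  have hli : LinearIndependent ℂ fun k : Fin n × Fin 2 => (f k.1 k.2 : V) := by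
    rw [Fintype.linearIndependent_iff]
    intro g hg k
    rw [Fintype.sum_prod_type] at hg
    have hind := (iSupIndep_iff_finsetSum_eq_zero_imp_eq_zero _).1
      (M.eigenspaces_iSupIndep.comp hl) Finset.univ
      (fun i => ∑ r, g (i, r) • (f i r : V))
      (fun i _ => Submodule.sum_mem _ fun r _ => Submodule.smul_mem _ _ (f i r).2) hg
    have h0 := hind k.1 (Finset.mem_univ _)
    exact Fintype.linearIndependent_iff.1 (hf k.1) (fun r => g (k.1, r))
      (Subtype.ext (by simpa using h0)) k.2
  refine ⟨basisOfLinearIndependentOfCardEqFinrank' _ hli (by simp [hV, mul_comm]), fun k => ?_⟩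
  rw [coe_basisOfLinearIndependentOfCardEqFinrank']
  exact Module.End.mem_eigenspace_iff.1 (f k.1 k.2).2

section Eigenbasis

variable {M : Module.End ℂ V} {l : Fin n → ℂ} {b : Module.Basis (Fin n × Fin 2) ℂ V}

lemma coord_comp_eigenbasis (hb : ∀ k, M (b k) = l k.1 • b k) (k : Fin n × Fin 2) (x : V) :
    b.coord k (M x) = l k.1 * b.coord k x := by
  have : b.coord k ∘ₗ M = l k.1 • b.coord k := by
    refine b.ext fun j => ?_
    by_cases hjk : j = k
    · subst hjk
      simp [hb]
    · simp [hb, hjk]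
  exact LinearMap.congr_fun this x

lemma exists_eq_of_eigenvector (hb : ∀ k, M (b k) = l k.1 • b k) {μ : ℂ} {x : V} (hx : x ≠ 0)
    (hμ : M x = μ • x) : ∃ j, μ = l j := by
  obtain ⟨k, hk⟩ : ∃ k, b.coord k x ≠ 0 := by
    by_contra! h
    exact hx (b.forall_coord_eq_zero_iff.1 h)
  refine ⟨k.1, ?_⟩
  have := coord_comp_eigenbasis hb k x
  rw [hμ, map_smul, smul_eq_mul] at this
  exact mul_right_cancel₀ hk this

lemma mem_span_of_eigenvector (hl : Function.Injective l) (hb : ∀ k, M (b k) = l k.1 • b k)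
    {j : Fin n} {x : V} (hx : M x = l j • x) : x ∈ Submodule.span ℂ {b (j, 0), b (j, 1)} := by
  have h0 : ∀ i, i ≠ j → ∀ r, b.repr x (i, r) = 0 := fun i hij r => by
    have := coord_comp_eigenbasis hb (i, r) x
    rw [hx, map_smul, smul_eq_mul, ← sub_eq_zero, ← sub_mul] at this
    exact (mul_eq_zero.1 this).resolve_left (sub_ne_zero.2 fun h => hij (hl h).symm)
  rw [← b.sum_repr x, Fintype.sum_prod_type, Finset.sum_eq_single j]
  · rw [Fin.sum_univ_two]
    exact Submodule.mem_span_pair.2 ⟨_, _, rfl⟩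
  · intro i _ hij
    simp [h0 i hij]
  · simp

/-- A 2-vector without mixed coordinates is a combination of the 2-vectors of the blocks. -/
lemma eq_sum_of_block (b : Module.Basis (Fin n × Fin 2) ℂ V) (γ : ⋀[ℂ]^2 V)
    (h : ∀ k m : Fin n × Fin 2, k.1 ≠ m.1 → b.coord k (contract γ (b.coord m)) = 0) :
    γ = ∑ i, b.coord (i, 0) (contract γ (b.coord (i, 1))) • wedge (b (i, 0)) (b (i, 1)) := by
  have hexp : ∀ m : Fin n × Fin 2, contract γ (b.coord m) =
      b.coord (m.1, 0) (contract γ (b.coord m)) • b (m.1, 0) +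
        b.coord (m.1, 1) (contract γ (b.coord m)) • b (m.1, 1) := fun m => by
    conv_lhs => rw [← b.sum_repr (contract γ (b.coord m)), Fintype.sum_prod_type,
      Finset.sum_eq_single m.1 (fun i _ hi => Finset.sum_eq_zero fun r _ => by
        have := h (i, r) m hi
        rw [Module.Basis.coord_apply] at this
        rw [this, zero_smul]) (by simp), Fin.sum_univ_two]
    rfl
  have h2 := sum_wedge_contract b γ
  refine smul_right_injective _ (two_ne_zero (α := ℂ)) ?_
  simp only
  rw [← h2, Fintype.sum_prod_type, Finset.smul_sum]
  refine Finset.sum_congr rfl fun i _ => ?_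
  -- Skewness kills the diagonal coordinates of the block and makes the other two opposite.
  have h0 : contract γ (b.coord (i, 0)) =
      -b.coord (i, 0) (contract γ (b.coord (i, 1))) • b (i, 1) := by
    rw [← apply_contract_swap]
    simpa only [apply_contract_self, zero_smul, zero_add] using hexp (i, 0)
  have h1 : contract γ (b.coord (i, 1)) =
      b.coord (i, 0) (contract γ (b.coord (i, 1))) • b (i, 0) := by
    simpa only [apply_contract_self, zero_smul, add_zero] using hexp (i, 1)
  set s := b.coord (i, 0) (contract γ (b.coord (i, 1)))
  rw [Fin.sum_univ_two, h0, h1, wedge_smul_left, wedge_smul_left, wedge_swap (b (i, 0)) (b (i, 1))]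
  module

/-- Write `α k m` for the coordinate in question. Skewness of both 2-vectors gives `l k * α k m = α'
k m = -α' m k = -l m * α m k = l m * α k m`, and the eigenvalues of distinct blocks differ. -/
lemma coord_contract_eq_zero {α α' : ⋀[ℂ]^2 V} (hl : Function.Injective l)
    (hb : ∀ k, M (b k) = l k.1 • b k) (hM : ∀ f, M (contract α f) = contract α' f)
    (k m : Fin n × Fin 2) (hkm : k.1 ≠ m.1) : b.coord k (contract α (b.coord m)) = 0 := by
  have h1 := apply_contract_swap α' (b.coord k) (b.coord m)
  rw [← hM, ← hM, coord_comp_eigenbasis hb, coord_comp_eigenbasis hb,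
    apply_contract_swap α (b.coord m), mul_neg, neg_neg, ← sub_eq_zero, ← sub_mul] at h1
  exact (mul_eq_zero.1 h1).resolve_left (sub_ne_zero.2 fun h => hkm (hl h))

end Eigenbasis

section Decomposition

variable {α α' : ⋀[ℂ]^2 V} {p q : Fin n → V}

lemma contract_sum_wedge (a : Fin n → ℂ) (p q : Fin n → V) (f : Module.Dual ℂ V) :
    contract (∑ i, a i • wedge (p i) (q i)) f = ∑ i, a i • (f (q i) • p i - f (p i) • q i) := by
  simp

/-- The vectors in a decomposition of a nondegenerate 2-vector of `ℂ²ⁿ` into `n` summands form a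
basis. -/
lemma exists_basis_of_decomposition [FiniteDimensional ℂ V] (hV : Module.finrank ℂ V = 2 * n)
    (hα : Function.Injective (contract α)) {a : Fin n → ℂ}
    (ha : α = ∑ i, a i • wedge (p i) (q i)) :
    ∃ e : Module.Basis (Fin n × Fin 2) ℂ V, ∀ i, e (i, 0) = p i ∧ e (i, 1) = q i := by
  let e : Fin n × Fin 2 → V := fun k => ![p k.1, q k.1] k.2
  have hsurj : Function.Surjective (contract α) :=
    (LinearMap.injective_iff_surjective_of_finrank_eq_finrank Subspace.dual_finrank_eq).1 hα
  -- The image of `contract α` is all of `V` and lies in the span of these `2n` vectors.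
  have hspan : ⊤ ≤ Submodule.span ℂ (Set.range e) := by
    intro x _
    obtain ⟨f, rfl⟩ := hsurj x
    rw [ha, contract_sum_wedge]
    refine Submodule.sum_mem _ fun i _ => Submodule.smul_mem _ _ (Submodule.sub_mem _
      (Submodule.smul_mem _ _ (Submodule.subset_span ⟨(i, 0), rfl⟩))
      (Submodule.smul_mem _ _ (Submodule.subset_span ⟨(i, 1), rfl⟩)))
  refine ⟨basisOfTopLeSpanOfCardEqFinrank e hspan (by simp [hV, mul_comm]), fun i => ?_⟩
  simp [e]

variable {e : Module.Basis (Fin n × Fin 2) ℂ V}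

lemma contract_coord_one (he : ∀ i, e (i, 0) = p i ∧ e (i, 1) = q i) (a : Fin n → ℂ) (i : Fin n) :
    contract (∑ i, a i • wedge (p i) (q i)) (e.coord (i, 1)) = a i • p i := by
  rw [contract_sum_wedge, Finset.sum_eq_single i]
  · simp [← (he i).1, ← (he i).2]
  · intro j _ hj
    simp [← (he j).1, ← (he j).2, hj]
  · simp

lemma contract_coord_zero (he : ∀ i, e (i, 0) = p i ∧ e (i, 1) = q i) (a : Fin n → ℂ) (i : Fin n) :
    contract (∑ i, a i • wedge (p i) (q i)) (e.coord (i, 0)) = -(a i • q i) := by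
  rw [contract_sum_wedge, Finset.sum_eq_single i]
  · simp [← (he i).1, ← (he i).2]
  · intro j _ hj
    simp [← (he j).1, ← (he j).2, hj]
  · simp

lemma linearIndependent_wedge (he : ∀ i, e (i, 0) = p i ∧ e (i, 1) = q i) :
    LinearIndependent ℂ fun i => wedge (p i) (q i) := by
  rw [Fintype.linearIndependent_iff]
  intro g hg i
  have h := contract_coord_one he g i
  rw [hg, map_zero, LinearMap.zero_apply] at h
  refine (smul_eq_zero.1 h.symm).resolve_right ?_
  rw [← (he i).1]
  exact e.ne_zero _

/-- On dual basis vectors, `α` and `α'` contract to multiples of the same `p i` or `q i`. The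
eigenvalue is the ratio `a' i / a i`, where `a i ≠ 0` by injectivity. -/
lemma exists_eigenvalue_of_decomposition {M : Module.End ℂ V}
    (hM : ∀ f, M (contract α f) = contract α' f) (hα : Function.Injective (contract α))
    {a a' : Fin n → ℂ} (ha : α = ∑ i, a i • wedge (p i) (q i))
    (ha' : α' = ∑ i, a' i • wedge (p i) (q i))
    (he : ∀ i, e (i, 0) = p i ∧ e (i, 1) = q i) (i : Fin n) :
    ∃ μ : ℂ, M (p i) = μ • p i ∧ M (q i) = μ • q i := by
  have h1 : contract α (e.coord (i, 1)) = a i • p i := ha ▸ contract_coord_one he a i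
  have h0 : contract α (e.coord (i, 0)) = -(a i • q i) := ha ▸ contract_coord_zero he a i
  have h1' : contract α' (e.coord (i, 1)) = a' i • p i := ha' ▸ contract_coord_one he a' i
  have h0' : contract α' (e.coord (i, 0)) = -(a' i • q i) := ha' ▸ contract_coord_zero he a' i
  have hai : a i ≠ 0 := by
    intro h
    rw [h, zero_smul] at h1
    have hz := hα (h1.trans (map_zero _).symm)
    have := LinearMap.congr_fun hz (e (i, 1))
    simp at this
  have hM1 := hM (e.coord (i, 1))
  have hM0 := hM (e.coord (i, 0))
  rw [h1, h1', map_smul] at hM1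
  rw [h0, h0', map_neg, map_smul, neg_inj] at hM0
  refine ⟨(a i)⁻¹ * a' i, ?_, ?_⟩
  · rw [mul_smul, ← hM1, inv_smul_smul₀ hai]
  · rw [mul_smul, ← hM0, inv_smul_smul₀ hai]

end Decomposition

/-- Simultaneous diagonalization of two 2-vectors whose quotient has `n` eigenvalues. -/
theorem exists_unique_decomposition [FiniteDimensional ℂ V] {α α' : ⋀[ℂ]^2 V} {M : Module.End ℂ V} {c : ℂ} (hc : c ≠ 0)
    (hV : Module.finrank ℂ V = 2 * n) (hα : Function.Injective (contract α))
    (hM : ∀ f, M (contract α f) = c • contract α' f) {l : Fin n → ℂ}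
    (hl : Function.Injective l) (hlM : ∀ i, M.HasEigenvalue (l i)) :
    ∃ b : Module.Basis (Fin n × Fin 2) ℂ V,
      (∃ a : Fin n → ℂ, α = ∑ i, a i • wedge (b (i, 0)) (b (i, 1))) ∧
      (∃ a : Fin n → ℂ, α' = ∑ i, a i • wedge (b (i, 0)) (b (i, 1))) ∧
      ∀ p q : Fin n → V, (∀ i, wedge (p i) (q i) ≠ 0) →
        (∃ a : Fin n → ℂ, α = ∑ i, a i • wedge (p i) (q i)) →
        (∃ a : Fin n → ℂ, α' = ∑ i, a i • wedge (p i) (q i)) →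
        ∃ (σ : Equiv.Perm (Fin n)) (d : Fin n → ℂˣ),
          ∀ i, wedge (p i) (q i) = d i • wedge (b (σ i, 0)) (b (σ i, 1)) := by
  have hM' : ∀ f, M (contract α f) = contract (c • α') f := fun f => by rw [hM]; simp
  obtain ⟨b, hb⟩ := exists_eigenbasis M hV hl
    fun i => two_le_finrank_eigenspace (hV ▸ even_two_mul n) hα hM' (hlM i)
  have hblock := coord_contract_eq_zero hl hb hM'
  refine ⟨b, ⟨_, eq_sum_of_block b α hblock⟩, ⟨_, eq_sum_of_block b α' fun k m hkm => ?_⟩, ?_⟩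
  · have h1 := congrArg (b.coord k) (hM (b.coord m))
    rw [coord_comp_eigenbasis hb, hblock k m hkm, mul_zero, map_smul, smul_eq_mul] at h1
    exact (mul_eq_zero.1 h1.symm).resolve_left hc
  rintro p q hpq ⟨a, ha⟩ ⟨a', ha'⟩
  obtain ⟨e, he⟩ := exists_basis_of_decomposition hV hα ha
  have ha'' : c • α' = ∑ i, (c * a' i) • wedge (p i) (q i) := by
    rw [ha', Finset.smul_sum]
    simp only [mul_smul]
  choose μ hμp hμq using exists_eigenvalue_of_decomposition hM' hα ha ha'' he
  choose σ hσ using fun i => exists_eq_of_eigenvector hb (by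
    rw [← (he i).1]
    exact e.ne_zero _) (hμp i)
  have hp : ∀ i, p i ∈ Submodule.span ℂ {b (σ i, 0), b (σ i, 1)} := fun i =>
    mem_span_of_eigenvector hl hb (hσ i ▸ hμp i)
  have hq : ∀ i, q i ∈ Submodule.span ℂ {b (σ i, 0), b (σ i, 1)} := fun i =>
    mem_span_of_eigenvector hl hb (hσ i ▸ hμq i)
  -- If `σ` missed the block `j`, the coordinate `(j, 0)` would vanish on the whole basis `e`.
  have hsurj : Function.Surjective σ := by
    intro j
    by_contra! hj
    have hvan : ∀ i, ∀ x ∈ Submodule.span ℂ {b (σ i, 0), b (σ i, 1)}, b.coord (j, 0) x = 0 := by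
      intro i x hx
      obtain ⟨s, t, rfl⟩ := Submodule.mem_span_pair.1 hx
      simp [hj i]
    have h0 : b.coord (j, 0) = 0 := by
      refine e.ext fun ⟨i, r⟩ => ?_
      fin_cases r
      · exact (he i).1 ▸ hvan i _ (hp i)
      · exact (he i).2 ▸ hvan i _ (hq i)
    have := LinearMap.congr_fun h0 (b (j, 0))
    simp at this
  have hd : ∀ i, ∃ d : ℂˣ, wedge (p i) (q i) = d • wedge (b (σ i, 0)) (b (σ i, 1)) := by
    intro i
    have hmem := wedge_mem_wedgeTwo (hp i) (hq i)
    rw [wedgeTwo_span_pair] at hmem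
    obtain ⟨d, hd⟩ := Submodule.mem_span_singleton.1 hmem
    have hd0 : d ≠ 0 := by
      rintro rfl
      exact hpq i (by rw [← hd, zero_smul])
    exact ⟨Units.mk0 d hd0, hd.symm⟩
  choose d hd using hd
  exact ⟨Equiv.ofBijective σ (Finite.surjective_iff_bijective.1 hsurj), d, hd⟩

end Diagonalization

/-! ### The hypersurface to be avoided. -/

section Genericity

/-- A polynomial in the entries of `A` and `A'` which for an invertible matrix `A` of size `2n`
vanishes if the quotient of `A'` by `A` has fewer than `n` eigenvalues. -/
def genericityDet {ι R : Type*} [Fintype ι] [DecidableEq ι] [CommRing R] (n : ℕ)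
    (A A' : Matrix ι ι R) : R :=
  A.det * (Matrix.of fun i j : Fin n => ((A' * A.adjugate) ^ (i + j : ℕ)).trace).det

lemma map_genericityDet {ι R S : Type*} [Fintype ι] [DecidableEq ι] [CommRing R] [CommRing S]
    (f : R →+* S) (n : ℕ) (A A' : Matrix ι ι R) :
    f (genericityDet n A A') = genericityDet n (f.mapMatrix A) (f.mapMatrix A') := by
  rw [genericityDet, genericityDet, map_mul, RingHom.map_det, RingHom.map_det,
    ← RingHom.map_adjugate]
  congr 2
  ext i j
  rw [RingHom.mapMatrix_apply, Matrix.map_apply, Matrix.of_apply, Matrix.of_apply, ← map_mul,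
    ← map_pow, RingHom.mapMatrix_apply, Matrix.trace, Matrix.trace, map_sum]
  rfl

variable {V : Type*} [AddCommGroup V] [Module ℂ V]
variable {ι : Type*} [Fintype ι] [DecidableEq ι]

/-- The matrix of the contraction with a 2-vector. -/
noncomputable def contractMatrix (b : Module.Basis ι ℂ V) (γ : ⋀[ℂ]^2 V) : Matrix ι ι ℂ :=
  LinearMap.toMatrix b.dualBasis b (contract γ)

lemma contractMatrix_apply (b : Module.Basis ι ℂ V) (γ : ⋀[ℂ]^2 V) (k m : ι) :
    contractMatrix b γ k m = b.coord k (contract γ (b.coord m)) := by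
  simp [contractMatrix, LinearMap.toMatrix_apply]

/-- The pairs of 2-vectors outside a hypersurface, which turn out to be general. -/
def IsGeneric (n : ℕ) (b : Module.Basis ι ℂ V) (w : ⋀[ℂ]^2 V × ⋀[ℂ]^2 V) : Prop :=
  genericityDet n (contractMatrix b w.1) (contractMatrix b w.2) ≠ 0

/-- The same determinant is formed over the polynomial ring, with matrix entries as variables;
evaluation commutes with it. -/
lemma exists_polynomial_isGeneric_iff (n : ℕ) (b : Module.Basis ι ℂ V) :
    ∃ p : MvPolynomial (Module.Dual ℂ (⋀[ℂ]^2 V × ⋀[ℂ]^2 V)) ℂ,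
      ∀ w, IsGeneric n b w ↔ MvPolynomial.eval (fun φ => φ w) p ≠ 0 := by
  let entry : ι → ι → Module.Dual ℂ (⋀[ℂ]^2 V) := fun k m =>
    b.coord k ∘ₗ contract.flip (b.coord m)
  refine ⟨genericityDet n
    (Matrix.of fun k m => MvPolynomial.X (entry k m ∘ₗ LinearMap.fst ℂ _ _))
    (Matrix.of fun k m => MvPolynomial.X (entry k m ∘ₗ LinearMap.snd ℂ _ _)), fun w => ?_⟩
  rw [map_genericityDet, IsGeneric]
  have h1 : contractMatrix b w.1 = (MvPolynomial.eval fun φ => φ w).mapMatrix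
      (Matrix.of fun k m => MvPolynomial.X (entry k m ∘ₗ LinearMap.fst ℂ _ _)) := by
    ext k m
    simp [contractMatrix_apply, entry]
  have h2 : contractMatrix b w.2 = (MvPolynomial.eval fun φ => φ w).mapMatrix
      (Matrix.of fun k m => MvPolynomial.X (entry k m ∘ₗ LinearMap.snd ℂ _ _)) := by
    ext k m
    simp [contractMatrix_apply, entry]
  rw [h1, h2]

/-- The adjugate replaces the inverse to stay polynomial: `M` has matrix `A' * A.adjugate`, whence
`c = A.det`. -/
lemma IsGeneric.exists_eigenvalues {n : ℕ} {b : Module.Basis ι ℂ V}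
    {w : ⋀[ℂ]^2 V × ⋀[ℂ]^2 V} (h : IsGeneric n b w) :
    Function.Injective (contract w.1) ∧
      ∃ (M : Module.End ℂ V) (c : ℂ) (l : Fin n → ℂ), c ≠ 0 ∧
        (∀ f, M (contract w.1 f) = c • contract w.2 f) ∧
        Function.Injective l ∧ ∀ i, M.HasEigenvalue (l i) := by
  set A := contractMatrix b w.1 with hA
  set A' := contractMatrix b w.2 with hA'
  have hdet : A.det ≠ 0 := left_ne_zero_of_mul h
  have hcard := le_card_roots_charpoly (A' * A.adjugate) (right_ne_zero_of_mul h)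
  obtain ⟨s, hs, hsn⟩ := Finset.exists_subset_card_eq hcard
  refine ⟨(LinearEquiv.ofIsUnitDet (v := b.dualBasis) (v' := b)
    (f := contract w.1) (isUnit_iff_ne_zero.2 hdet)).injective,
    Matrix.toLin b b (A' * A.adjugate), A.det, fun i => (s.equivFinOfCardEq hsn).symm i, hdet,
    fun f => ?_, Subtype.val_injective.comp (Equiv.injective _), fun i => ?_⟩
  · have hcomp : Matrix.toLin b b (A' * A.adjugate) ∘ₗ Matrix.toLin b.dualBasis b A =
        A.det • Matrix.toLin b.dualBasis b A' := by
      rw [← Matrix.toLin_mul, Matrix.mul_assoc, Matrix.adjugate_mul, Matrix.mul_smul,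
        Matrix.mul_one, map_smul]
    rw [hA, hA', contractMatrix, contractMatrix, Matrix.toLin_toMatrix, Matrix.toLin_toMatrix]
      at hcomp
    exact LinearMap.congr_fun hcomp f
  · have hroot := hs ((s.equivFinOfCardEq hsn).symm i).2
    rw [Multiset.mem_toFinset] at hroot
    have : FiniteDimensional ℂ V := b.finiteDimensional_of_finite
    rw [Module.End.hasEigenvalue_iff_isRoot_charpoly, Matrix.charpoly_toLin]
    exact Polynomial.isRoot_of_mem_roots hroot

/-- A relation `s α + t α' = 0` forces `t * l i = -(c * s)` for every `i`, and two distinct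
eigenvalues then give `t = 0`. For `n = 1` the Plücker space is only one-dimensional. -/
lemma IsGeneric.linearIndependent {n : ℕ} (hn : 2 ≤ n) {b : Module.Basis ι ℂ V}
    {w : ⋀[ℂ]^2 V × ⋀[ℂ]^2 V} (h : IsGeneric n b w) : LinearIndependent ℂ ![w.1, w.2] := by
  have : FiniteDimensional ℂ V := b.finiteDimensional_of_finite
  obtain ⟨hinj, M, c, l, hc, hM, hl, hlM⟩ := h.exists_eigenvalues
  have hsurj : Function.Surjective (contract w.1) :=
    (LinearMap.injective_iff_surjective_of_finrank_eq_finrank Subspace.dual_finrank_eq).1 hinj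
  refine LinearIndependent.pair_iff.2 fun s t hst => ?_
  have key : ∀ i, t * l i = -(c * s) := fun i => by
    obtain ⟨x, hx⟩ := (hlM i).exists_hasEigenvector
    obtain ⟨f, rfl⟩ := hsurj x
    have h1 := hM f
    rw [hx.apply_eq_smul] at h1
    have h2 : s • contract w.1 f + t • contract w.2 f = 0 := by
      simpa using LinearMap.congr_fun (congrArg contract hst) f
    have h3 : (t * l i + c * s) • contract w.1 f = 0 := by
      rw [add_smul, mul_smul, h1, mul_smul, smul_comm t c, ← smul_add, add_comm, h2, smul_zero]
    exact eq_neg_of_add_eq_zero_left ((smul_eq_zero.1 h3).resolve_right hx.2)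
  have ht : t = 0 := by
    have h01 := (key ⟨0, by omega⟩).trans (key ⟨1, by omega⟩).symm
    by_contra ht
    have := hl (mul_left_cancel₀ ht h01)
    simp at this
  refine ⟨?_, ht⟩
  have := key ⟨0, by omega⟩
  rw [ht, zero_mul, eq_comm, neg_eq_zero] at this
  exact (mul_eq_zero.1 this).resolve_left hc

lemma exists_isGeneric {n : ℕ} (b : Module.Basis (Fin n × Fin 2) ℂ V) :
    ∃ w, IsGeneric n b w := by
  have : FiniteDimensional ℂ V := b.finiteDimensional_of_finite
  have he : ∀ i, b (i, 0) = b (i, 0) ∧ b (i, 1) = b (i, 1) := fun i => ⟨rfl, rfl⟩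
  let S : (Fin n → ℂ) → ⋀[ℂ]^2 V := fun a => ∑ i, a i • wedge (b (i, 0)) (b (i, 1))
  have h1 : ∀ a i, contract (S a) (b.coord (i, 1)) = a i • b (i, 0) := contract_coord_one he
  have h0 : ∀ a i, contract (S a) (b.coord (i, 0)) = -(a i • b (i, 1)) := contract_coord_zero he
  clear_value S
  -- The distinct coefficients `0, …, n - 1` of the second 2-vector become, up to the factor
  -- `A.det`, the eigenvalues.
  refine ⟨(S fun _ => 1, S fun i => (i : ℂ)), ?_⟩
  set A := contractMatrix b (S fun _ => 1) with hA
  have hA' : contractMatrix b (S fun i => (i : ℂ)) =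
      Matrix.diagonal (fun k : Fin n × Fin 2 => (k.1 : ℂ)) * A := by
    ext k ⟨i, r⟩
    rw [Matrix.diagonal_mul, hA, contractMatrix_apply, contractMatrix_apply]
    have hk : ∀ s : Fin 2, (k.1 : ℂ) * b.coord k (b (i, s)) = i * b.coord k (b (i, s)) :=
      fun s => by
        by_cases hki : k = (i, s)
        · rw [hki]
        · simp [Ne.symm hki]
    fin_cases r
    · change b.coord k (contract _ (b.coord (i, 0))) = _ * b.coord k (contract _ (b.coord (i, 0)))
      rw [h0, h0, map_neg, map_neg, map_smul, one_smul, smul_eq_mul, mul_neg, hk 1]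
    · change b.coord k (contract _ (b.coord (i, 1))) = _ * b.coord k (contract _ (b.coord (i, 1)))
      rw [h1, h1, map_smul, one_smul, smul_eq_mul, hk 0]
  have hdet : A.det ≠ 0 := by
    have hrange : LinearMap.range (contract (S fun _ => 1)) = ⊤ := by
      rw [eq_top_iff, ← b.span_eq, Submodule.span_le]
      rintro _ ⟨⟨i, r⟩, rfl⟩
      fin_cases r
      · exact ⟨b.coord (i, 1), by simp [h1]⟩
      · exact ⟨-b.coord (i, 0), by simp [h0]⟩
    have hsurj := LinearMap.range_eq_top.1 hrange
    have hinj := (LinearMap.injective_iff_surjective_of_finrank_eq_finrank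
      Subspace.dual_finrank_eq).2 hsurj
    exact (LinearEquiv.isUnit_det (LinearEquiv.ofBijective _ ⟨hinj, hsurj⟩) b.dualBasis b).ne_zero
  refine mul_ne_zero hdet ?_
  rw [hA', Matrix.mul_assoc, Matrix.mul_adjugate, Matrix.mul_smul, Matrix.mul_one]
  let W : Matrix (Fin n) (Fin n) ℂ := Matrix.vandermonde fun i => A.det * (i : ℂ)
  -- Each eigenvalue occurs twice, so the Hankel matrix of power sums is twice a Vandermonde
  -- product.
  have hH : (Matrix.of fun i j : Fin n => ((A.det • Matrix.diagonal
      (fun k : Fin n × Fin 2 => (k.1 : ℂ))) ^ (i + j : ℕ)).trace) = (2 : ℂ) • (W.transpose * W) := by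
    ext i j
    simp only [Matrix.of_apply, smul_pow, Matrix.diagonal_pow, Matrix.trace_smul,
      Matrix.trace_diagonal, Fintype.sum_prod_type, Fin.sum_univ_two, Matrix.smul_apply,
      Matrix.mul_apply, Matrix.transpose_apply, W, Matrix.vandermonde_apply, Pi.pow_apply,
      smul_eq_mul, Finset.mul_sum]
    refine Finset.sum_congr rfl fun k _ => ?_
    ring
  have hW : W.det ≠ 0 := Matrix.det_vandermonde_ne_zero_iff.2 fun i j hij => by
    have := mul_left_cancel₀ hdet hij
    exact Fin.ext (by exact_mod_cast this)
  rw [hH, Matrix.det_smul, Matrix.det_mul, Matrix.det_transpose]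
  exact mul_ne_zero (pow_ne_zero _ two_ne_zero) (mul_ne_zero hW hW)

end Genericity

/-! ### From diagonalizing tuples to secant spaces. -/

section Secant

variable {n : ℕ}

lemma exists_rank_eq_two_of_mem_grassmannian {x : ℙ ℂ (Pluecker n)} (hx : x ∈ grassmannian n) :
    ∃ γ : Pluecker n, rank γ = 2 ∧ x.submodule = Submodule.span ℂ {γ} := by
  obtain ⟨U, hU, hxU⟩ := hx
  obtain ⟨u, v, huv, rfl⟩ := exists_span_pair_of_finrank_eq_two hU
  exact ⟨wedge u v, (rank_eq_two_iff _).2 ⟨u, v, huv, rfl⟩, by rw [hxU, wedgeTwo_span_pair]⟩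

lemma mk_mem_grassmannian {γ : Pluecker n} (hγ : rank γ = 2) (h0 : γ ≠ 0) :
    Projectivization.mk ℂ γ h0 ∈ grassmannian n := by
  obtain ⟨u, v, huv, rfl⟩ := (rank_eq_two_iff _).1 hγ
  exact ⟨_, finrank_span_pair_eq_two huv,
    by rw [Projectivization.submodule_mk, wedgeTwo_span_pair]⟩

/-- In this form the condition depends on `α` and `α'` only through the line that they span. -/
lemma isDiagonalizing_iff {α α' : Pluecker n} {γ : Fin n → Pluecker n} :
    IsDiagonalizing α α' γ ↔ (∀ i, rank (γ i) = 2) ∧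
      Submodule.span ℂ {α, α'} ≤ Submodule.span ℂ (Set.range γ) := by
  rw [IsDiagonalizing, Submodule.span_le, Set.insert_subset_iff, Set.singleton_subset_iff,
    SetLike.mem_coe, SetLike.mem_coe, Submodule.mem_span_range_iff_exists_fun,
    Submodule.mem_span_range_iff_exists_fun]
  simp only [eq_comm]

lemma IsSecantSpace.exists_span_eq {P : Submodule ℂ (Pluecker n)} (hP : IsSecantSpace P) :
    ∃ δ : Fin n → Pluecker n, (∀ i, rank (δ i) = 2) ∧ P = Submodule.span ℂ (Set.range δ) := by
  obtain ⟨-, x, hx, rfl⟩ := hP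
  choose δ hδ hxδ using fun i => exists_rank_eq_two_of_mem_grassmannian (hx i)
  exact ⟨δ, hδ, by simp only [hxδ, Submodule.span_range_eq_iSup]⟩

/-- Secant spaces containing the line of `α` and `α'`, if these are diagonalized in a unique way. -/
theorem secantSpace_of_unique {α α' : Pluecker n} {γ : Fin n → Pluecker n}
    (hγ : IsDiagonalizing α α' γ) (hli : LinearIndependent ℂ γ)
    (huniq : ∀ δ : Fin n → Pluecker n, IsDiagonalizing α α' δ →
      ∃ (σ : Equiv.Perm (Fin n)) (c : Fin n → ℂˣ), ∀ i, δ i = c i • γ (σ i)) :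
    (∃! P : Submodule ℂ (Pluecker n), IsSecantSpace P ∧ Submodule.span ℂ {α, α'} ≤ P) ∧
      ∀ P : Submodule ℂ (Pluecker n), IsSecantSpace P → Submodule.span ℂ {α, α'} ≤ P →
        {x ∈ grassmannian n | x.submodule ≤ P}.ncard = n := by
  obtain ⟨hrank, hle⟩ := isDiagonalizing_iff.1 hγ
  have h0 : ∀ i, γ i ≠ 0 := fun i => hli.ne_zero i
  have hsecant : IsSecantSpace (Submodule.span ℂ (Set.range γ)) := by
    refine ⟨by rw [finrank_span_eq_card hli, Fintype.card_fin],
      fun i => Projectivization.mk ℂ (γ i) (h0 i), fun i => mk_mem_grassmannian (hrank i) _, ?_⟩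
    simp only [Projectivization.submodule_mk, Submodule.span_range_eq_iSup]
  have heq : ∀ P : Submodule ℂ (Pluecker n), IsSecantSpace P → Submodule.span ℂ {α, α'} ≤ P →
      P = Submodule.span ℂ (Set.range γ) := by
    intro P hP hLP
    obtain ⟨δ, hδ, rfl⟩ := hP.exists_span_eq
    obtain ⟨σ, c, hc⟩ := huniq δ (isDiagonalizing_iff.2 ⟨hδ, hLP⟩)
    apply le_antisymm
    · rw [Submodule.span_le]
      rintro _ ⟨i, rfl⟩
      rw [hc i]
      exact Submodule.smul_mem _ _ (Submodule.subset_span ⟨σ i, rfl⟩)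
    · rw [Submodule.span_le]
      rintro _ ⟨i, rfl⟩
      have : γ i = (c (σ.symm i))⁻¹ • δ (σ.symm i) := by
        rw [hc, inv_smul_smul, Equiv.apply_symm_apply]
      rw [this]
      exact Submodule.smul_mem _ _ (Submodule.subset_span ⟨_, rfl⟩)
  refine ⟨⟨_, ⟨hsecant, hle⟩, fun P hP => heq P hP.1 hP.2⟩, fun P hP hLP => ?_⟩
  rw [heq P hP hLP]
  have hset : {x ∈ grassmannian n | x.submodule ≤ Submodule.span ℂ (Set.range γ)} =
      Set.range fun i => Projectivization.mk ℂ (γ i) (h0 i) := by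
    ext x
    constructor
    · rintro ⟨hx, hxP⟩
      obtain ⟨ε, hε, hxε⟩ := exists_rank_eq_two_of_mem_grassmannian hx
      have hε0 : ε ≠ 0 := by
        rintro rfl
        obtain ⟨u, v, huv, h⟩ := (rank_eq_two_iff _).1 hε
        exact wedge_ne_zero huv h.symm
      rw [hxε, Submodule.span_singleton_le_iff_mem] at hxP
      obtain ⟨c, hc⟩ := (Submodule.mem_span_range_iff_exists_fun ℂ).1 hxP
      obtain ⟨i, hi⟩ : ∃ i, c i ≠ 0 := by
        by_contra! h
        exact hε0 (by rw [← hc]; simp [h])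
      -- Exchange: as `c i ≠ 0`, replacing `γ i` by `ε` leaves a diagonalizing tuple, and uniqueness
      -- makes `ε` proportional to some `γ (σ i)`.
      have hmem : ∀ j, j ≠ i → γ j ∈ Submodule.span ℂ (Set.range (Function.update γ i ε)) :=
        fun j hj => Submodule.subset_span ⟨j, by simp [hj]⟩
      have hspan : Submodule.span ℂ (Set.range γ) ≤
          Submodule.span ℂ (Set.range (Function.update γ i ε)) := by
        rw [Submodule.span_le]
        rintro _ ⟨j, rfl⟩
        by_cases hj : j = i
        · subst hj
          have hεj : c j • γ j = ε - ∑ k ∈ Finset.univ.erase j, c k • γ k := by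
            rw [← hc, ← Finset.add_sum_erase _ _ (Finset.mem_univ j), add_sub_cancel_right]
          have : c j • γ j ∈ Submodule.span ℂ (Set.range (Function.update γ j ε)) := by
            rw [hεj]
            refine Submodule.sub_mem _ (Submodule.subset_span ⟨j, by simp⟩)
              (Submodule.sum_mem _ fun k hk => Submodule.smul_mem _ _ (hmem k ?_))
            exact Finset.ne_of_mem_erase hk
          exact (Submodule.smul_mem_iff _ hi).1 this
        · exact hmem j hj
      obtain ⟨σ, d, hd⟩ := huniq (Function.update γ i ε) (isDiagonalizing_iff.2 ⟨fun j => by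
        by_cases hj : j = i
        · subst hj
          simpa using hε
        · simpa [hj] using hrank j, hle.trans hspan⟩)
      have hεd : ε = d i • γ (σ i) := by simpa using hd i
      refine ⟨σ i, Projectivization.submodule_injective ?_⟩
      rw [hxε, Projectivization.submodule_mk, hεd]
      exact (Submodule.span_singleton_group_smul_eq ℂ (d i) (γ (σ i))).symm
    · rintro ⟨i, rfl⟩
      refine ⟨mk_mem_grassmannian (hrank i) _, ?_⟩
      rw [Projectivization.submodule_mk, Submodule.span_singleton_le_iff_mem]
      exact Submodule.subset_span ⟨i, rfl⟩
  rw [hset, Set.ncard_range_of_injective, Nat.card_fin]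
  intro i j hij
  by_contra hne
  obtain ⟨a, ha⟩ := (Projectivization.mk_eq_mk_iff' ℂ _ _ _ _).1 hij
  refine hli.notMem_span_image (s := {j}) (x := i) (by simpa using hne) ?_
  rw [Set.image_singleton]
  exact Submodule.mem_span_singleton.2 ⟨a, ha⟩

end Secant

/-! ### Zariski open sets of pairs and of lines. -/

section General

variable {n : ℕ}

/-- A basis of `ℂ²ⁿ` indexed by `n` pairs. -/
noncomputable def pairBasis (n : ℕ) : Module.Basis (Fin n × Fin 2) ℂ (Fin (2 * n) → ℂ) :=
  (Pi.basisFun ℂ (Fin (2 * n))).reindex (Fintype.equivOfCardEq (by simp [mul_comm]))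

theorem IsGeneric.exists_unique_isDiagonalizing {w : Pluecker n × Pluecker n}
    (h : IsGeneric n (pairBasis n) w) :
    ∃ γ : Fin n → Pluecker n, LinearIndependent ℂ γ ∧ IsDiagonalizing w.1 w.2 γ ∧
      ∀ δ : Fin n → Pluecker n, IsDiagonalizing w.1 w.2 δ →
        ∃ (σ : Equiv.Perm (Fin n)) (c : Fin n → ℂˣ), ∀ i, δ i = c i • γ (σ i) := by
  obtain ⟨hinj, M, c, l, hc, hM, hl, hlM⟩ := h.exists_eigenvalues
  obtain ⟨b, hb, hb', huniq⟩ := exists_unique_decomposition hc (by simp) hinj hM hl hlM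
  refine ⟨fun i => wedge (b (i, 0)) (b (i, 1)), linearIndependent_wedge fun i => ⟨rfl, rfl⟩,
    ⟨fun i => (rank_eq_two_iff _).2 ⟨_, _, ?_, rfl⟩, hb, hb'⟩, ?_⟩
  · have := b.linearIndependent.comp (fun r : Fin 2 => (i, r)) fun r s hrs => (Prod.ext_iff.1 hrs).2
    convert this using 1
    ext r
    fin_cases r <;> rfl
  · rintro δ ⟨hδ, ha, ha'⟩
    choose p q hpq hδpq using fun i => (rank_eq_two_iff _).1 (hδ i)
    obtain rfl : δ = fun i => wedge (p i) (q i) := funext hδpq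
    exact huniq p q (fun i => wedge_ne_zero (hpq i)) ha ha'

variable {W W' : Type*} [AddCommGroup W] [Module ℂ W] [AddCommGroup W'] [Module ℂ W']

/-- The complement is the common zero locus of the pullbacks of `p`. The identity alone serves for
pairs, all linear substitutions for lines. -/
lemma isZariskiOpen_setOf_exists_ne {κ : Type*} (T : κ → W →ₗ[ℂ] W')
    (p : MvPolynomial (Module.Dual ℂ W') ℂ) :
    IsZariskiOpen {w : W | ∃ k, MvPolynomial.eval (fun φ => φ (T k w)) p ≠ 0} := by
  refine ⟨Set.range fun k => MvPolynomial.rename (fun φ => φ ∘ₗ T k) p, ?_⟩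
  ext w
  simp only [Set.mem_compl_iff, Set.mem_ofPred_eq, zeroLocus, Set.forall_mem_range,
    MvPolynomial.eval_rename, not_exists, not_not]
  rfl

/-- The linear substitution in pairs of vectors. -/
def pairSubst (W : Type*) [AddCommGroup W] [Module ℂ W] (k : Fin 4 → ℂ) : W × W →ₗ[ℂ] W × W :=
  (k 0 • LinearMap.fst ℂ W W + k 1 • LinearMap.snd ℂ W W).prod
    (k 2 • LinearMap.fst ℂ W W + k 3 • LinearMap.snd ℂ W W)

/-- Since `p` need not be invariant under change of frame, all substitutions of the frame are tried.
By `hp`, a substitution with nonzero value yields independent vectors, so it does not change the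
line. -/
lemma isZariskiOpenLines_of_polynomial (p : MvPolynomial (Module.Dual ℂ (W × W)) ℂ)
    (hp : ∀ w : W × W, MvPolynomial.eval (fun φ => φ w) p ≠ 0 →
      LinearIndependent ℂ ![w.1, w.2]) :
    IsZariskiOpenLines {L : ProjLine W | ∃ w : W × W, MvPolynomial.eval (fun φ => φ w) p ≠ 0 ∧
      Submodule.span ℂ {w.1, w.2} = L.1} := by
  rw [IsZariskiOpenLines]
  convert isZariskiOpen_setOf_exists_ne (pairSubst W) p using 1
  ext w
  constructor
  · rintro ⟨L, ⟨w', hw', hL'⟩, hL⟩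
    obtain ⟨a, b, h1⟩ := Submodule.mem_span_pair.1
      (hL ▸ hL' ▸ Submodule.subset_span (by simp) : w'.1 ∈ Submodule.span ℂ {w.1, w.2})
    obtain ⟨c, d, h2⟩ := Submodule.mem_span_pair.1
      (hL ▸ hL' ▸ Submodule.subset_span (by simp) : w'.2 ∈ Submodule.span ℂ {w.1, w.2})
    refine ⟨![a, b, c, d], ?_⟩
    have : pairSubst W ![a, b, c, d] w = w' := by
      ext <;> simp [pairSubst, h1, h2]
    rwa [this]
  · rintro ⟨k, hk⟩
    have hli := finrank_span_pair_eq_two (hp _ hk)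
    refine ⟨⟨_, hli⟩, ⟨_, hk, rfl⟩, ?_⟩
    symm
    have : FiniteDimensional ℂ (Submodule.span ℂ {w.1, w.2}) :=
      FiniteDimensional.span_of_finite ℂ (Set.toFinite _)
    refine Submodule.eq_of_le_of_finrank_le ?_ ?_
    · rw [Submodule.span_le, Set.insert_subset_iff, Set.singleton_subset_iff]
      exact ⟨Submodule.mem_span_pair.2 ⟨_, _, rfl⟩, Submodule.mem_span_pair.2 ⟨_, _, rfl⟩⟩
    · rw [hli]
      classical
      have := finrank_span_finset_le_card (R := ℂ) ({w.1, w.2} : Finset W)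
      rw [Finset.coe_pair] at this
      exact this.trans Finset.card_le_two

end General

end TwoVector

theorem mainTheorem12 (n : ℕ) :
    TwoVector.HoldsGenerally (W := TwoVector.Pluecker n × TwoVector.Pluecker n) (fun w =>
      ∃ γ : Fin n → TwoVector.Pluecker n, TwoVector.IsDiagonalizing w.1 w.2 γ ∧
        ∀ δ : Fin n → TwoVector.Pluecker n, TwoVector.IsDiagonalizing w.1 w.2 δ →
          ∃ (σ : Equiv.Perm (Fin n)) (c : Fin n → ℂˣ), ∀ i, δ i = c i • γ (σ i)) ∧
    (2 ≤ n → TwoVector.HoldsForGeneralLine (W := TwoVector.Pluecker n) (fun L =>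
      (∃! P : Submodule ℂ (TwoVector.Pluecker n), TwoVector.IsSecantSpace P ∧ L.1 ≤ P) ∧
        ∀ P : Submodule ℂ (TwoVector.Pluecker n), TwoVector.IsSecantSpace P → L.1 ≤ P →
          {x ∈ TwoVector.grassmannian n | x.submodule ≤ P}.ncard = n)) := by
  obtain ⟨p, hp⟩ := TwoVector.exists_polynomial_isGeneric_iff n (TwoVector.pairBasis n)
  obtain ⟨w₀, hw₀⟩ := TwoVector.exists_isGeneric (TwoVector.pairBasis n)
  refine ⟨⟨{w | MvPolynomial.eval (fun φ => φ w) p ≠ 0}, ?_, ⟨w₀, (hp w₀).1 hw₀⟩, fun w hw => ?_⟩,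
    fun hn => ⟨_, TwoVector.isZariskiOpenLines_of_polynomial p fun w hw =>
      ((hp w).2 hw).linearIndependent hn, ?_, ?_⟩⟩
  · simpa using TwoVector.isZariskiOpen_setOf_exists_ne (fun _ : Unit => LinearMap.id) p
  · obtain ⟨γ, -, h⟩ := ((hp w).2 hw).exists_unique_isDiagonalizing
    exact ⟨γ, h⟩
  · exact ⟨⟨_, TwoVector.finrank_span_pair_eq_two (hw₀.linearIndependent hn)⟩,
      w₀, (hp w₀).1 hw₀, rfl⟩
  · rintro ⟨L, hL⟩ ⟨w, hw, rfl⟩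
    obtain ⟨γ, hli, hγ, huniq⟩ := ((hp w).2 hw).exists_unique_isDiagonalizing
    exact TwoVector.secantSpace_of_unique hγ hli huniq
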